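/- Let $k_n=2^n$ and let $H=\ell^2$ be the space of square-summable real sequences. A finite-energy solution on a time interval $I$ is a family $X=(X_n)_{n\ge 0}$ of continuously differentiable functions $X_n:I\to\mathbb{R}$ (one-sided derivatives at end points belonging to $I$) such that for all $t\in I$ $$X_0(t)=0,\qquad \dot X_n(t)=k_{n-1}X_{n-1}^2(t)-k_nX_n(t)X_{n+1}(t)\quad(n\ge 1),$$ and $X(t)=(X_n(t))_n\in H$. No condition is imposed on the signs of the components. (1) Coalescence. Let $t_0\in\mathbb{R}$ and let $X_n(t)=\frac{a_n}{t-t_0}$, $t>t_0$, be a finite-energy self-similar solution on $(t_0,\infty)$ with $(a_n)$ not identically zero. Then every value of $X$ is a coalescence point: for every $t_1>t_0$ there is a finite-energy solution $X^{t_1}$ on $(-\infty,t_1]$ such that $X^{t_1}(t_1)=X(t_1)$ and $X^{t_1}(t)\ne X(t)$ for every $t\in(t_0,t_1)$. (2) Non-uniqueness. Uniqueness fails in the class of finite-energy solutions of arbitrary sign: there are $u\in H$ with $u_n\le 0$ for all $n$, and two different finite-energy solutions on $[0,\infty)$ with the same initial condition $u$. -/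

import Mathlib

namespace Dyadic

/-- The coefficients `k_n = 2^n`. -/
def k (n : ℕ) : ℝ := 2 ^ n

/-- `X` (with `X t n` standing for `X_n(t)`) is a componentwise solution, on the time interval `I`,
of `X_0 = 0`, `X_n' = k_{n-1} X_{n-1}^2 - k_n X_n X_{n+1}` for `n ≥ 1` (below, `n + 1` plays the role
of `n`). Derivatives at an end point of `I` that belongs to `I` are one-sided. Each component is
automatically continuously differentiable on `I`, because the right-hand side is continuous on `I`
as soon as all components are differentiable there. -/
structure IsComponentwiseSolution (I : Set ℝ) (X : ℝ → ℕ → ℝ) : Prop where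
  zero : ∀ t ∈ I, X t 0 = 0
  hasDeriv : ∀ t ∈ I, ∀ n : ℕ,
    HasDerivWithinAt (fun s => X s (n + 1))
      (k n * X t n ^ 2 - k (n + 1) * X t (n + 1) * X t (n + 2)) I t

/-- A componentwise solution on `I` all of whose values lie in `H = ℓ²` (the component of index `0`
vanishes, so it does not matter that it is included in the sum). -/
structure IsFiniteEnergySolution (I : Set ℝ) (X : ℝ → ℕ → ℝ) : Prop
    extends IsComponentwiseSolution I X where
  finite_energy : ∀ t ∈ I, Memℓp (X t) 2

/-- A (finite energy, not identically zero) self-similar solution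
`X_n(t) = a_n / (t - t₀)`, `t > t₀`. -/
structure IsSelfSimilarSolution (t₀ : ℝ) (a : ℕ → ℝ) (X : ℝ → ℕ → ℝ) : Prop
    extends IsFiniteEnergySolution (Set.Ioi t₀) X where
  form : ∀ t ∈ Set.Ioi t₀, ∀ n : ℕ, X t n = a n / (t - t₀)
  nontrivial : a ≠ 0

end Dyadic

/-! The nonlinearity formally conserves energy, and its Galerkin truncations conserve it exactly,
forward and backward in time. Their limit is a solution on the whole line through any prescribed
datum, with energy nowhere above that of the datum (`exists_solution`). Both claims compare such a
solution with one whose energy does exceed that of the datum. Coalescence: a nonzero self-similar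
solution has strictly more energy before `t₁` than at `t₁`, so the solution built from its value at
`t₁` cannot meet it earlier. Non-uniqueness: a nonnegative solution started from a unit vector loses
energy (`IsFiniteEnergySolution.energy_le`). Its time reversal with a change of sign starts from a
nonpositive datum and regains that energy, while the solution built from the same datum cannot. -/

namespace Dyadic

open Filter Topology Set Metric Finset

/-! ### Existence of solutions with controlled energy -/

section Existence

/-- A `C¹` vector field on a finite-dimensional inner product space that is everywhere orthogonal
to the position vector has integral curves of constant norm on every bounded interval. -/
theorem exists_integralCurve_of_inner_eq_zero {E : Type*} [NormedAddCommGroup E]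
    [InnerProductSpace ℝ E] [FiniteDimensional ℝ E] {B : E → E} (hB : ContDiff ℝ 1 B)
    (horth : ∀ x, inner ℝ x (B x) = 0) (x₀ : E) {T : ℝ} (hT : 0 ≤ T) :
    ∃ α : ℝ → E, α 0 = x₀ ∧
      (∀ t ∈ Icc (-T) T, HasDerivWithinAt α (B (α t)) (Icc (-T) T) t) ∧
      ∀ t ∈ Icc (-T) T, ‖α t‖ = ‖x₀‖ := by
  -- The cutoff makes the field bounded and globally Lipschitz while keeping it orthogonal to
  -- position. The norm is therefore conserved and the curve stays where the cutoff equals `1`.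
  let χ : ContDiffBump (0 : E) := ⟨‖x₀‖ + 1, ‖x₀‖ + 2, by positivity, by linarith⟩
  let v : E → E := fun x => χ x • B x
  have hv : ContDiff ℝ 1 v := χ.contDiff.smul hB
  have hvs : HasCompactSupport v := χ.hasCompactSupport.smul_right
  obtain ⟨K, hK⟩ := ContDiff.lipschitzWith_of_hasCompactSupport hvs hv one_ne_zero
  obtain ⟨L, hL⟩ := hvs.exists_bound_of_continuous hv.continuous
  have hL0 : 0 ≤ L := (norm_nonneg _).trans (hL 0)
  have hmem : (0 : ℝ) ∈ Icc (-T) T := ⟨by linarith, hT⟩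
  have hP : IsPicardLindelof (fun _ : ℝ => v) (⟨0, hmem⟩ : Icc (-T) T) x₀
      ⟨L * T, mul_nonneg hL0 hT⟩ 0 ⟨L, hL0⟩ K := by
    apply IsPicardLindelof.of_time_independent
    · intro x _
      exact hL x
    · exact hK.lipschitzOnWith
    · simp only [sub_zero, zero_sub, neg_neg, max_self, NNReal.coe_zero]
      exact le_rfl
  obtain ⟨α, hα0, hα⟩ := hP.exists_eq_forall_mem_Icc_hasDerivWithinAt₀
  have hα0 : α 0 = x₀ := hα0
  have hvorth : ∀ x, inner ℝ x (v x) = 0 := fun x => by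
    simp only [v, inner_smul_right, horth, mul_zero]
  have hnorm : ∀ t ∈ Icc (-T) T, ‖α t‖ = ‖x₀‖ := by
    intro t ht
    have hd : ∀ s ∈ Icc (-T) T,
        HasDerivWithinAt (fun s => ‖α s‖ ^ 2) 0 (Icc (-T) T) s := by
      intro s hs
      have h := (hα s hs).norm_sq
      rwa [hvorth, mul_zero] at h
    have h := (convex_Icc (-T) T).norm_image_sub_le_of_norm_hasDerivWithin_le (C := 0) hd
      (fun _ _ => by simp) hmem ht
    rw [zero_mul, norm_le_zero_iff, sub_eq_zero, hα0] at h
    exact (pow_left_inj₀ (norm_nonneg _) (norm_nonneg _) two_ne_zero).1 h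
  refine ⟨α, hα0, fun t ht => ?_, hnorm⟩
  have h1 : χ (α t) = 1 := χ.one_of_mem_closedBall (by
    rw [mem_closedBall_zero_iff, hnorm t ht]
    change ‖x₀‖ ≤ ‖x₀‖ + 1
    linarith)
  have h := hα t ht
  simp only [v, h1, one_smul] at h
  exact h

/-- Embedding of `ℝ^N` into sequences, placing coordinates at the indices `1, …, N`. -/
noncomputable def extend {N : ℕ} (x : EuclideanSpace ℝ (Fin N)) : ℕ → ℝ
  | 0 => 0
  | n + 1 => if h : n < N then x ⟨n, h⟩ else 0

theorem extend_succ_of_lt {N n : ℕ} (x : EuclideanSpace ℝ (Fin N)) (h : n < N) :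
    extend x (n + 1) = x ⟨n, h⟩ := by simp [extend, h]

theorem extend_succ_of_le {N n : ℕ} (x : EuclideanSpace ℝ (Fin N)) (h : N ≤ n) :
    extend x (n + 1) = 0 := by simp [extend, h]

theorem contDiff_extend {N : ℕ} (n : ℕ) :
    ContDiff ℝ 1 (fun x : EuclideanSpace ℝ (Fin N) => extend x n) := by
  cases n with
  | zero => exact contDiff_const
  | succ n =>
    by_cases h : n < N
    · simp only [extend_succ_of_lt _ h]
      fun_prop
    · simp only [extend_succ_of_le _ (not_lt.1 h)]
      exact contDiff_const

theorem sum_extend_sq_le {N : ℕ} (x : EuclideanSpace ℝ (Fin N)) (n : ℕ) :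
    ∑ i ∈ range n, extend x i ^ 2 ≤ ‖x‖ ^ 2 := by
  have hN : ∑ i ∈ range (N + 1), extend x i ^ 2 = ‖x‖ ^ 2 := by
    rw [EuclideanSpace.norm_sq_eq, sum_range_succ', ← Fin.sum_univ_eq_sum_range
      (fun i => extend x (i + 1) ^ 2)]
    simp [extend]
  rw [← hN]
  rcases le_total n (N + 1) with h | h
  · exact sum_le_sum_of_subset_of_nonneg (range_subset_range.2 h) fun _ _ _ => sq_nonneg _
  · refine (sum_subset (range_subset_range.2 h) fun i _ hi => ?_).ge
    obtain ⟨j, rfl⟩ : ∃ j, i = j + 1 := ⟨i - 1, by simp at hi; omega⟩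
    rw [extend_succ_of_le _ (by simpa using hi)]
    simp

/-- The truncated vector field of the dyadic model. -/
noncomputable def truncatedField (N : ℕ) (x : EuclideanSpace ℝ (Fin N)) :
    EuclideanSpace ℝ (Fin N) :=
  WithLp.toLp 2 fun i =>
    k i * extend x i ^ 2 - k (i + 1) * extend x (i + 1) * extend x (i + 2)

theorem contDiff_truncatedField (N : ℕ) : ContDiff ℝ 1 (truncatedField N) := by
  rw [contDiff_euclidean]
  intro i
  have h0 := contDiff_extend (N := N) i
  have h1 := contDiff_extend (N := N) (i + 1)
  have h2 := contDiff_extend (N := N) (i + 2)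
  simp only [truncatedField]
  fun_prop

/-- The energy fluxes telescope; both boundary fluxes vanish because `extend x` is zero at the
indices `0` and `N + 1`. -/
theorem inner_truncatedField (N : ℕ) (x : EuclideanSpace ℝ (Fin N)) :
    inner ℝ x (truncatedField N x) = 0 := by
  have h : ∀ i : Fin N, inner ℝ (x i) (truncatedField N x i) =
      (fun j : ℕ => k j * extend x j ^ 2 * extend x (j + 1)
        - k (j + 1) * extend x (j + 1) ^ 2 * extend x (j + 1 + 1)) i := by
    intro i
    have hx : x i = extend x (i + 1) := by simp [extend]
    rw [hx]
    simp only [truncatedField, RCLike.inner_apply, conj_trivial]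
    ring
  rw [PiLp.inner_apply, sum_congr rfl fun i _ => h i, Fin.sum_univ_eq_sum_range
    (fun j : ℕ => k j * extend x j ^ 2 * extend x (j + 1)
        - k (j + 1) * extend x (j + 1) ^ 2 * extend x (j + 1 + 1)),
    sum_range_sub' (fun j : ℕ => k j * extend x j ^ 2 * extend x (j + 1)),
    extend_succ_of_le x le_rfl]
  simp [extend]

/-- The right-hand side of the equation for the component of index `n + 1`. -/
noncomputable def rhs (u : ℕ → ℝ) (n : ℕ) : ℝ :=
  k n * u n ^ 2 - k (n + 1) * u (n + 1) * u (n + 2)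

/-- Galerkin approximations exist on bounded intervals, and do not increase the energy. -/
theorem exists_truncated_solution (N : ℕ) {T : ℝ} (hT : 0 ≤ T) {u : ℕ → ℝ} {S : ℝ}
    (hu : u 0 = 0) (hS : ∀ n, ∑ i ∈ range n, u i ^ 2 ≤ S) :
    ∃ x : ℝ → ℕ → ℝ, (∀ t, x t 0 = 0) ∧ (∀ n ≤ N, x 0 n = u n) ∧
      (∀ t ∈ Icc (-T) T, ∀ n < N,
        HasDerivWithinAt (fun s => x s (n + 1)) (rhs (x t) n) (Icc (-T) T) t) ∧
      ∀ t ∈ Icc (-T) T, ∀ n, ∑ i ∈ range n, x t i ^ 2 ≤ S := by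
  let x₀ : EuclideanSpace ℝ (Fin N) := WithLp.toLp 2 fun i => u (i + 1)
  obtain ⟨α, h0, hα, hn⟩ := exists_integralCurve_of_inner_eq_zero (contDiff_truncatedField N)
    (inner_truncatedField N) x₀ hT
  refine ⟨fun t => extend (α t), fun t => rfl, ?_, ?_, ?_⟩
  · intro n hn
    cases n with
    | zero => exact hu.symm
    | succ n => simp [h0, extend_succ_of_lt x₀ hn, x₀]
  · intro t ht n hn
    have h := (EuclideanSpace.proj (𝕜 := ℝ) (⟨n, hn⟩ : Fin N)).hasFDerivAt.comp_hasDerivWithinAt t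
      (hα t ht)
    simp only [extend_succ_of_lt _ hn]
    exact h
  · intro t ht n
    refine (sum_extend_sq_le _ n).trans ?_
    rw [hn t ht]
    refine le_trans (le_of_eq ?_) (hS (N + 1))
    rw [EuclideanSpace.norm_sq_eq, sum_range_succ', ← Fin.sum_univ_eq_sum_range
      (fun i => u (i + 1) ^ 2)]
    simp [hu, x₀]

theorem abs_le_of_sum_sq_le {u : ℕ → ℝ} {R : ℝ} (hR : 0 ≤ R)
    (h : ∀ n, ∑ i ∈ range n, u i ^ 2 ≤ R ^ 2) (n : ℕ) : |u n| ≤ R := by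
  refine abs_le_of_sq_le_sq ?_ hR
  exact (single_le_sum (f := fun i => u i ^ 2) (fun _ _ => sq_nonneg _)
    (self_mem_range_succ n)).trans (h (n + 1))

theorem k_pos (n : ℕ) : 0 < k n := by unfold k; positivity

theorem abs_rhs_le {u : ℕ → ℝ} {R : ℝ} (h : ∀ n, |u n| ≤ R) (n : ℕ) :
    |rhs u n| ≤ k n * R ^ 2 + k (n + 1) * R ^ 2 := by
  have hR : 0 ≤ R := (abs_nonneg _).trans (h 0)
  unfold rhs
  refine (abs_sub _ _).trans ?_
  rw [abs_mul, abs_mul, abs_mul, abs_pow, abs_of_pos (k_pos n),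
    abs_of_pos (k_pos (n + 1)), _root_.mul_assoc, sq R, sq |u n|]
  have := (k_pos n).le
  have := (k_pos (n + 1)).le
  gcongr <;> exact h _

theorem abs_mul_sub_mul_le {a b c d R D : ℝ} (ha : |a| ≤ R) (hd : |d| ≤ R) (hac : |a - c| ≤ D)
    (hbd : |b - d| ≤ D) : |a * b - c * d| ≤ 2 * R * D := by
  have h : a * b - c * d = a * (b - d) + (a - c) * d := by ring
  have hR : 0 ≤ R := (abs_nonneg _).trans ha
  have hD : 0 ≤ D := (abs_nonneg _).trans hac
  rw [h]
  refine (abs_add_le _ _).trans ?_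
  rw [abs_mul, abs_mul]
  nlinarith [mul_le_mul ha hbd (abs_nonneg _) hR, mul_le_mul hac hd (abs_nonneg _) hD]

theorem abs_rhs_sub_rhs_le {u w : ℕ → ℝ} {R D : ℝ} {n : ℕ} (hu : ∀ n, |u n| ≤ R)
    (hw : ∀ n, |w n| ≤ R) (hD : ∀ i ≤ n + 2, |u i - w i| ≤ D) :
    |rhs u n - rhs w n| ≤ (k n + k (n + 1)) * (2 * R * D) := by
  have h1 := abs_mul_sub_mul_le (hu n) (hw n) (hD n (by omega)) (hD n (by omega))
  have h2 := abs_mul_sub_mul_le (hu (n + 1)) (hw (n + 2)) (hD (n + 1) (by omega))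
    (hD (n + 2) le_rfl)
  have h : rhs u n - rhs w n = k n * (u n * u n - w n * w n)
      - k (n + 1) * (u (n + 1) * u (n + 2) - w (n + 1) * w (n + 2)) := by
    unfold rhs; ring
  rw [h]
  refine (abs_sub _ _).trans ?_
  rw [abs_mul, abs_mul, abs_of_pos (k_pos n), abs_of_pos (k_pos (n + 1)), _root_.add_mul]
  have := (k_pos n).le
  have := (k_pos (n + 1)).le
  gcongr

/-- Second-order Taylor bound for bounded solutions of the first few equations. -/
theorem exists_taylor_bound (R : ℝ) (n : ℕ) : ∃ C : ℝ, ∀ (T : ℝ) (x : ℝ → ℕ → ℝ),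
    (∀ t ∈ Icc (-T) T, ∀ i, |x t i| ≤ R) → (∀ t, x t 0 = 0) →
    (∀ t ∈ Icc (-T) T, ∀ i ≤ n + 1,
      HasDerivWithinAt (fun s => x s (i + 1)) (rhs (x t) i) (Icc (-T) T) t) →
    ∀ t ∈ Icc (-T) T, ∀ s ∈ Icc (-T) T,
      |x s (n + 1) - x t (n + 1) - (s - t) * rhs (x t) n| ≤ C * (s - t) ^ 2 := by
  let D : ℝ := k (n + 1) * R ^ 2 + k (n + 2) * R ^ 2
  refine ⟨(k n + k (n + 1)) * (2 * R * D), fun T x hR h0 hx t ht s hs => ?_⟩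
  have hR0 : 0 ≤ R := (abs_nonneg _).trans (hR t ht 0)
  have hmono : Monotone k := fun a b hab => pow_le_pow_right₀ one_le_two hab
  have hD0 : 0 ≤ D := by
    have := k_pos (n + 1)
    have := k_pos (n + 2)
    positivity
  -- `rhs` at `n` involves the component `n + 2`, whose Lipschitz bound comes from equation `n + 1`;
  -- hence the range `i ≤ n + 1` in the hypothesis.
  have hlip : ∀ r ∈ Icc (-T) T, ∀ i ≤ n + 2, |x r i - x t i| ≤ D * |r - t| := by
    intro r hr i hi
    cases i with
    | zero => simp only [h0, sub_self, abs_zero]; positivity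
    | succ i =>
      refine (convex_Icc (-T) T).norm_image_sub_le_of_norm_hasDerivWithin_le
        (fun q hq => hx q hq i (by omega)) (fun q hq => ?_) ht hr
      refine (abs_rhs_le (hR q hq) i).trans ?_
      have h1 : k i ≤ k (n + 1) := hmono (by omega)
      have h2 : k (i + 1) ≤ k (n + 2) := hmono (by omega)
      simp only [D]
      gcongr
  have hsub : uIcc t s ⊆ Icc (-T) T := uIcc_subset_Icc ht hs
  have hd : ∀ q ∈ uIcc t s, HasDerivWithinAt (fun r => x r (n + 1) - r * rhs (x t) n)
      (rhs (x q) n - rhs (x t) n) (uIcc t s) q := by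
    intro q hq
    have h := ((hx q (hsub hq) n (by omega)).mono hsub).sub
      ((hasDerivWithinAt_id q (uIcc t s)).mul_const (rhs (x t) n))
    rw [_root_.one_mul] at h
    exact h
  have h := (convex_uIcc t s).norm_image_sub_le_of_norm_hasDerivWithin_le
    (C := (k n + k (n + 1)) * (2 * R * D) * |s - t|) hd (fun q hq => ?_)
    left_mem_uIcc right_mem_uIcc
  · rw [Real.norm_eq_abs, Real.norm_eq_abs, _root_.mul_assoc _ |s - t|, ← sq, sq_abs] at h
    convert h using 2
    ring
  · refine (abs_rhs_sub_rhs_le (hR q (hsub hq)) (hR t ht) (hlip q (hsub hq))).trans ?_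
    have hq' : |q - t| ≤ |s - t| := by
      rcases le_total t s with hts | hts
      · rw [uIcc_of_le hts] at hq
        rw [abs_of_nonneg (by linarith [hq.1]), abs_of_nonneg (by linarith)]
        linarith [hq.2]
      · rw [uIcc_of_ge hts] at hq
        rw [abs_of_nonpos (by linarith [hq.2]), abs_of_nonpos (by linarith)]
        linarith [hq.1]
    have := k_pos n
    have := k_pos (n + 1)
    calc (k n + k (n + 1)) * (2 * R * (D * |q - t|))
        = (k n + k (n + 1)) * (2 * R * D) * |q - t| := by ring
      _ ≤ _ := by gcongr

theorem hasDerivAt_of_abs_le_sq {f : ℝ → ℝ} {t g C δ : ℝ} (hδ : 0 < δ)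
    (h : ∀ s, |s - t| < δ → |f s - f t - (s - t) * g| ≤ C * (s - t) ^ 2) :
    HasDerivAt f g t := by
  rw [hasDerivAt_iff_isLittleO]
  have h1 : (fun s => f s - f t - (s - t) • g) =O[𝓝 t] fun s => (s - t) ^ 2 := by
    refine Asymptotics.IsBigO.of_bound C ?_
    filter_upwards [ball_mem_nhds t hδ] with s hs
    rw [Real.norm_eq_abs, Real.norm_eq_abs, abs_of_nonneg (sq_nonneg (s - t)), smul_eq_mul]
    exact h s hs
  refine h1.trans_isLittleO ?_
  have h2 : (fun s : ℝ => s - t) =o[𝓝 t] fun _ => (1 : ℝ) := by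
    rw [Asymptotics.isLittleO_one_iff]
    have : Tendsto (fun s : ℝ => s - t) (𝓝 t) (𝓝 (t - t)) := by
      exact (continuous_id.sub continuous_const).tendsto t
    simpa using this
  simpa [sq] using h2.mul_isBigO (Asymptotics.isBigO_refl (fun s : ℝ => s - t) (𝓝 t))

/-- Every initial datum of finite energy is the value at time `0` of a componentwise solution on
the whole line whose energy never exceeds the energy of the datum. -/
theorem exists_solution_zero {u : ℕ → ℝ} {S : ℝ} (hu : u 0 = 0)
    (hS : ∀ n, ∑ i ∈ range n, u i ^ 2 ≤ S) :
    ∃ X : ℝ → ℕ → ℝ, IsComponentwiseSolution univ X ∧ X 0 = u ∧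
      ∀ t n, ∑ i ∈ range n, X t i ^ 2 ≤ S := by
  have hS0 : 0 ≤ S := by simpa using hS 0
  choose x hx0 hxu hxd hxS using fun N : ℕ =>
    exists_truncated_solution N (T := N) (Nat.cast_nonneg N) hu hS
  have hR : ∀ N : ℕ, ∀ t ∈ Icc (-(N : ℝ)) N, ∀ i, |x N t i| ≤ √S := fun N t ht =>
    abs_le_of_sum_sq_le (Real.sqrt_nonneg S) (by
      rw [Real.sq_sqrt hS0]
      exact hxS N t ht)
  have hmem : ∀ t : ℝ, ∀ᶠ N : ℕ in hyperfilter ℕ, t ∈ Icc (-(N : ℝ)) N := fun t => by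
    have h : ∀ᶠ N : ℕ in atTop, t ∈ Icc (-(N : ℝ)) N := by
      filter_upwards [tendsto_natCast_atTop_atTop.eventually_ge_atTop |t|] with N hN
      exact abs_le.1 hN
    exact h.filter_mono Nat.hyperfilter_le_atTop
  -- Along one ultrafilter all components converge at all times, which replaces Arzelà–Ascoli and a
  -- diagonal extraction.
  have hlim : ∀ t n, ∃ y, Tendsto (fun N => x N t n) (hyperfilter ℕ) (𝓝 y) := by
    intro t n
    obtain ⟨y, -, hy⟩ := (isCompact_Icc (a := -√S) (b := √S)).ultrafilter_le_nhds
      ((hyperfilter ℕ).map fun N => x N t n) (by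
        rw [le_principal_iff]
        exact (hmem t).mono fun N hN => abs_le.1 (hR N t hN n))
    exact ⟨y, hy⟩
  choose X hX using hlim
  have hge : ∀ n : ℕ, ∀ᶠ N : ℕ in hyperfilter ℕ, n ≤ N := fun n =>
    (eventually_ge_atTop n).filter_mono Nat.hyperfilter_le_atTop
  refine ⟨X, ⟨fun t _ => ?_, fun t _ n => ?_⟩, ?_, ?_⟩
  · refine tendsto_nhds_unique (hX t 0) ?_
    simp only [hx0]
    exact tendsto_const_nhds
  · obtain ⟨C, hC⟩ := exists_taylor_bound (√S) n
    refine (hasDerivAt_of_abs_le_sq (C := C) one_pos fun s _ => ?_).hasDerivWithinAt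
    have hrhs : Tendsto (fun N => rhs (x N t) n) (hyperfilter ℕ) (𝓝 (rhs (X t) n)) :=
      (((hX t n).pow 2).const_mul _).sub (((hX t (n + 1)).const_mul _).mul (hX t (n + 2)))
    refine le_of_tendsto
      ((((hX s (n + 1)).sub (hX t (n + 1))).sub (hrhs.const_mul (s - t))).abs) ?_
    filter_upwards [hmem t, hmem s, hge (n + 2)] with N ht hs hN
    exact hC N (x N) (hR N) (hx0 N) (fun q hq i hi => hxd N q hq i (by omega)) t ht s hs
  · funext n
    refine tendsto_nhds_unique (hX 0 n) (tendsto_const_nhds.congr' ?_)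
    filter_upwards [hge n] with N hN
    exact (hxu N n hN).symm
  · intro t n
    refine le_of_tendsto (tendsto_finsetSum _ fun i _ => (hX t i).pow 2) ?_
    filter_upwards [hmem t] with N hN
    exact hxS N t hN n

theorem memℓp_of_sum_sq_le {u : ℕ → ℝ} {S : ℝ} (h : ∀ n, ∑ i ∈ range n, u i ^ 2 ≤ S) :
    Memℓp u 2 := by
  refine memℓp_gen' (C := S) fun s => ?_
  obtain ⟨n, hn⟩ := s.exists_nat_subset_range
  refine le_trans ?_ (h n)
  simp only [ENNReal.toReal_ofNat, Real.rpow_ofNat, Real.norm_eq_abs, sq_abs]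
  exact sum_le_sum_of_subset_of_nonneg hn fun _ _ _ => sq_nonneg _

theorem IsFiniteEnergySolution.mono {I J : Set ℝ} {X : ℝ → ℕ → ℝ}
    (h : IsFiniteEnergySolution J X) (hIJ : I ⊆ J) : IsFiniteEnergySolution I X where
  zero t ht := h.zero t (hIJ ht)
  hasDeriv t ht n := (h.hasDeriv t (hIJ ht) n).mono hIJ
  finite_energy t ht := h.finite_energy t (hIJ ht)

/-- Existence of a finite-energy solution on the whole line with prescribed value at time `t₁` and
energy nowhere larger than at time `t₁`. -/
theorem exists_solution (t₁ : ℝ) {u : ℕ → ℝ} {S : ℝ} (hu : u 0 = 0)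
    (hS : ∀ n, ∑ i ∈ range n, u i ^ 2 ≤ S) :
    ∃ X : ℝ → ℕ → ℝ, IsFiniteEnergySolution univ X ∧ X t₁ = u ∧
      ∀ t n, ∑ i ∈ range n, X t i ^ 2 ≤ S := by
  obtain ⟨X, hX, h0, hE⟩ := exists_solution_zero hu hS
  refine ⟨fun t => X (t - t₁), ⟨⟨fun t _ => hX.zero _ trivial, fun t _ n => ?_⟩,
    fun t _ => memℓp_of_sum_sq_le (hE _)⟩, by simpa using h0, fun t => hE _⟩
  have h := (hX.hasDeriv (t - t₁) trivial n).hasDerivAt univ_mem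
  exact (h.comp_sub_const t t₁).hasDerivWithinAt

end Existence

/-! ### Positivity, anomalous dissipation and time reversal -/

section Dissipation

theorem IsFiniteEnergySolution.hasDerivAt {X : ℝ → ℕ → ℝ} (h : IsFiniteEnergySolution univ X)
    (t : ℝ) (n : ℕ) : HasDerivAt (fun s => X s (n + 1))
      (k n * X t n ^ 2 - k (n + 1) * X t (n + 1) * X t (n + 2)) t :=
  (h.hasDeriv t trivial n).hasDerivAt univ_mem

theorem IsFiniteEnergySolution.continuous {X : ℝ → ℕ → ℝ} (h : IsFiniteEnergySolution univ X)
    (n : ℕ) : Continuous fun t => X t n := by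
  cases n with
  | zero => simpa only [h.zero _ trivial] using continuous_const
  | succ n => exact continuous_iff_continuousAt.2 fun t => (h.hasDerivAt t n).continuousAt

/-- The set of nonnegative sequences is forward invariant. -/
theorem IsFiniteEnergySolution.nonneg {X : ℝ → ℕ → ℝ} (h : IsFiniteEnergySolution univ X)
    (h0 : ∀ n, 0 ≤ X 0 n) {t : ℝ} (ht : 0 ≤ t) (n : ℕ) : 0 ≤ X t n := by
  cases n with
  | zero => exact (h.zero t trivial).ge
  | succ n =>
    let q : ℝ → ℝ := fun s => k (n + 1) * X s (n + 2)
    have hq : Continuous q := continuous_const.mul (h.continuous (n + 2))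
    let Q : ℝ → ℝ := fun s => ∫ r in (0 : ℝ)..s, q r
    have hQ : ∀ s, HasDerivAt Q (q s) s := fun s => hq.integral_hasStrictDerivAt 0 s |>.hasDerivAt
    -- The integrating factor removes the term linear in the component, leaving only the nonnegative
    -- input from the previous one.
    have hd : ∀ s, HasDerivAt (fun s => X s (n + 1) * Real.exp (Q s))
        (k n * X s n ^ 2 * Real.exp (Q s)) s := by
      intro s
      refine ((h.hasDerivAt s n).mul (hQ s).exp).congr_deriv ?_
      simp only [q]
      ring
    have hmono : Monotone fun s => X s (n + 1) * Real.exp (Q s) :=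
      monotone_of_hasDerivAt_nonneg hd fun s =>
        mul_nonneg (mul_nonneg (k_pos n).le (sq_nonneg _)) (Real.exp_pos _).le
    have h1 : 0 ≤ X t (n + 1) * Real.exp (Q t) :=
      (mul_nonneg (h0 (n + 1)) (Real.exp_pos _).le).trans (hmono ht)
    exact nonneg_of_mul_nonneg_left h1 (Real.exp_pos _)

/-- Energy balance of the first components. -/
theorem IsFiniteEnergySolution.hasDerivAt_energy {X : ℝ → ℕ → ℝ}
    (h : IsFiniteEnergySolution univ X) (t : ℝ) (n : ℕ) :
    HasDerivAt (fun s => ∑ i ∈ range (n + 1), X s i ^ 2)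
      (-(2 * k n * X t n ^ 2 * X t (n + 1))) t := by
  induction n with
  | zero =>
    simp only [zero_add, sum_range_one, h.zero _ trivial]
    simpa using hasDerivAt_const t (0 : ℝ)
  | succ n ih =>
    simp only [sum_range_succ _ (n + 1)]
    refine (ih.add ((h.hasDerivAt t n).pow 2)).congr_deriv ?_
    push_cast
    ring

theorem IsFiniteEnergySolution.antitoneOn_energy {X : ℝ → ℕ → ℝ}
    (h : IsFiniteEnergySolution univ X) (h0 : ∀ n, 0 ≤ X 0 n) (n : ℕ) :
    AntitoneOn (fun s => ∑ i ∈ range (n + 1), X s i ^ 2) (Ici 0) := by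
  refine antitoneOn_of_hasDerivWithinAt_nonpos (convex_Ici 0)
    (fun t _ => (h.hasDerivAt_energy t n).continuousAt.continuousWithinAt)
    (fun t _ => (h.hasDerivAt_energy t n).hasDerivWithinAt) fun t ht => ?_
  rw [interior_Ici] at ht
  have h1 := h.nonneg h0 (le_of_lt ht) (n + 1)
  have h2 := k_pos n
  have : 0 ≤ 2 * k n * X t n ^ 2 * X t (n + 1) := by positivity
  linarith

/-- The functional whose growth forces energy to leave a nonnegative solution: the weighted
components `2^{-n} X_{n+1}` account for `X_n²`, and the partial energies absorb the products
`X_{n+1} X_{n+2}`. -/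
noncomputable def lyapunov (N : ℕ) (u : ℕ → ℝ) : ℝ :=
  ∑ n ∈ range N, ((1 / 2) ^ n * u (n + 1) - 2 * (2 / 3) ^ n * ∑ i ∈ range (n + 2), u i ^ 2)

theorem sum_geometric_le {q : ℝ} (h0 : 0 ≤ q) (h1 : q < 1) (N : ℕ) :
    ∑ n ∈ range N, q ^ n ≤ (1 - q)⁻¹ := by
  rw [← tsum_geometric_of_lt_one h0 h1]
  exact (summable_geometric_of_lt_one h0 h1).sum_le_tsum _ fun n _ => pow_nonneg h0 n

theorem lyapunov_sub_le {u w : ℕ → ℝ} (hu1 : ∀ n, u n ≤ 1) (hw0 : ∀ n, 0 ≤ w n)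
    (hw : ∀ n, ∑ i ∈ range n, w i ^ 2 ≤ 1) (N : ℕ) : lyapunov N u - lyapunov N w ≤ 8 := by
  have h1 := sum_geometric_le (q := 1 / 2) (by norm_num) (by norm_num) N
  have h2 := sum_geometric_le (q := 2 / 3) (by norm_num) (by norm_num) N
  have h : lyapunov N u - lyapunov N w ≤
      ∑ n ∈ range N, (1 / 2 : ℝ) ^ n + 2 * ∑ n ∈ range N, (2 / 3 : ℝ) ^ n := by
    rw [mul_sum, ← sum_add_distrib, lyapunov, lyapunov, ← sum_sub_distrib]
    refine sum_le_sum fun n _ => ?_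
    have hp : (0 : ℝ) ≤ (1 / 2) ^ n := by positivity
    have hq : (0 : ℝ) ≤ 2 * (2 / 3) ^ n := by positivity
    have hs : 0 ≤ ∑ i ∈ range (n + 2), u i ^ 2 := sum_nonneg fun _ _ => sq_nonneg _
    have a1 := mul_le_mul_of_nonneg_left (hu1 (n + 1)) hp
    have a2 := mul_nonneg hp (hw0 (n + 1))
    have a3 := mul_le_mul_of_nonneg_left (hw (n + 2)) hq
    have a4 := mul_nonneg hq hs
    linarith
  norm_num at h1 h2
  linarith

/-- The growth rate of `lyapunov` along a solution is at least `E_N - 1/2`. -/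
theorem le_lyapunov_deriv {u : ℕ → ℝ} (hu0 : ∀ n, 0 ≤ u n) (hu1 : ∀ n, u n ≤ 1) (N : ℕ) :
    ∑ n ∈ range N, u n ^ 2 - 1 / 2 ≤
      ∑ n ∈ range N, ((1 / 2) ^ n * (k n * u n ^ 2 - k (n + 1) * u (n + 1) * u (n + 2))
        - 2 * (2 / 3) ^ n * -(2 * k (n + 1) * u (n + 1) ^ 2 * u (n + 2))) := by
  have h1 := sum_geometric_le (q := 3 / 4) (by norm_num) (by norm_num) N
  norm_num at h1
  -- The loss sums to at most `1/8 * 4 = 1/2`.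
  have h : ∑ n ∈ range N, u n ^ 2 - 1 / 8 * ∑ n ∈ range N, (3 / 4 : ℝ) ^ n ≤
      ∑ n ∈ range N, ((1 / 2) ^ n * (k n * u n ^ 2 - k (n + 1) * u (n + 1) * u (n + 2))
        - 2 * (2 / 3) ^ n * -(2 * k (n + 1) * u (n + 1) ^ 2 * u (n + 2))) := by
    rw [mul_sum, ← sum_sub_distrib]
    refine sum_le_sum fun n _ => ?_
    have e1 : (1 / 2 : ℝ) ^ n * 2 ^ n = 1 := by rw [← mul_pow]; norm_num
    have e2 : (2 / 3 : ℝ) ^ n * 2 ^ n = (4 / 3) ^ n := by rw [← mul_pow]; norm_num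
    have e3 : (4 / 3 : ℝ) ^ n * (3 / 4) ^ n = 1 := by rw [← mul_pow]; norm_num
    have e : (1 / 2) ^ n * (k n * u n ^ 2 - k (n + 1) * u (n + 1) * u (n + 2))
        - 2 * (2 / 3) ^ n * -(2 * k (n + 1) * u (n + 1) ^ 2 * u (n + 2))
        = u n ^ 2 - 2 * u (n + 1) * u (n + 2)
          + 8 * (4 / 3) ^ n * u (n + 1) ^ 2 * u (n + 2) := by
      rw [← e2]
      simp only [k, pow_succ]
      linear_combination (u n ^ 2 - 2 * u (n + 1) * u (n + 2)) * e1
    rw [e]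
    have hp : (0 : ℝ) ≤ (3 / 4) ^ n := by positivity
    -- Completing the square absorbs the negative product into the flux term. The weight `(2/3)^n`
    -- is summable, yet after multiplication by `k` it grows like `(4/3)^n`, so the remainder
    -- `(3/4)^n` is summable too.
    have a1 : 0 ≤ 1 / 8 * (3 / 4 : ℝ) ^ n * u (n + 2) *
        (8 * (4 / 3) ^ n * u (n + 1) - 1) ^ 2 :=
      mul_nonneg (mul_nonneg (by positivity) (hu0 _)) (sq_nonneg _)
    have a2 := mul_le_mul_of_nonneg_left (hu1 (n + 2)) hp
    have a3 : 1 / 8 * (3 / 4 : ℝ) ^ n * u (n + 2) * (8 * (4 / 3) ^ n * u (n + 1) - 1) ^ 2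
        = 8 * (4 / 3) ^ n * u (n + 1) ^ 2 * u (n + 2) - 2 * u (n + 1) * u (n + 2)
          + 1 / 8 * ((3 / 4) ^ n * u (n + 2)) := by
      linear_combination (8 * (4 / 3) ^ n * u (n + 1) ^ 2 * u (n + 2)
        - 2 * u (n + 1) * u (n + 2)) * e3
    linarith
  linarith

/-- Anomalous dissipation: a nonnegative solution of energy at most `1` has lost a definite amount
of energy by time `32`. -/
theorem IsFiniteEnergySolution.energy_le {X : ℝ → ℕ → ℝ} (h : IsFiniteEnergySolution univ X)
    (h0 : ∀ n, 0 ≤ X 0 n) (hE : ∀ t n, ∑ i ∈ range n, X t i ^ 2 ≤ 1) (n : ℕ) :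
    ∑ i ∈ range n, X 32 i ^ 2 ≤ 3 / 4 := by
  refine (sum_le_sum_of_subset_of_nonneg (range_subset_range.2 n.le_succ)
    fun _ _ _ => sq_nonneg _).trans ?_
  have h1 : ∀ t i, X t i ≤ 1 := fun t i =>
    (le_abs_self _).trans (abs_le_of_sum_sq_le zero_le_one (by simpa using hE t) i)
  let N := n + 1
  -- Partial energies decrease, so `m` bounds the growth rate of `lyapunov` from below on all of
  -- `[0, 32]`. The total growth is at most `8`, whence `m ≤ 8 / 32`.
  let m : ℝ := ∑ i ∈ range N, X 32 i ^ 2 - 1 / 2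
  have hd : ∀ t, HasDerivAt (fun s => lyapunov N (X s) - m * s)
      (∑ n ∈ range N, ((1 / 2) ^ n * (k n * X t n ^ 2 - k (n + 1) * X t (n + 1) * X t (n + 2))
        - 2 * (2 / 3) ^ n * -(2 * k (n + 1) * X t (n + 1) ^ 2 * X t (n + 2))) - m * 1) t :=
    fun t => (HasDerivAt.fun_sum fun n _ => ((h.hasDerivAt t n).const_mul _).sub
      ((h.hasDerivAt_energy t (n + 1)).const_mul _)).sub ((hasDerivAt_id t).const_mul m)
  have hmono : MonotoneOn (fun s => lyapunov N (X s) - m * s) (Icc 0 32) := by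
    refine monotoneOn_of_hasDerivWithinAt_nonneg (convex_Icc 0 32)
      (fun t _ => (hd t).continuousAt.continuousWithinAt)
      (fun t _ => (hd t).hasDerivWithinAt) fun t ht => ?_
    have ht := interior_subset ht
    have a1 := le_lyapunov_deriv (fun n => h.nonneg h0 ht.1 n) (h1 t) N
    have a2 : ∑ i ∈ range N, X 32 i ^ 2 ≤ ∑ i ∈ range N, X t i ^ 2 :=
      h.antitoneOn_energy h0 n ht.1 (ht.1.trans ht.2) ht.2
    simp only [m]
    linarith
  have h2 : lyapunov N (X 0) - m * 0 ≤ lyapunov N (X 32) - m * 32 :=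
    hmono (by norm_num) (by norm_num) (by norm_num)
  have h3 := lyapunov_sub_le (h1 32) h0 (hE 0) N
  have h4 : m ≤ 1 / 4 := by linarith
  simp only [m, N] at h4
  linarith

/-- The dyadic model is invariant under `X ↦ -X(T - ·)`. -/
theorem IsFiniteEnergySolution.reverse {X : ℝ → ℕ → ℝ} (h : IsFiniteEnergySolution univ X)
    (T : ℝ) : IsFiniteEnergySolution univ fun t n => -X (T - t) n where
  zero t _ := by rw [h.zero _ trivial, neg_zero]
  hasDeriv t _ n := by
    have h1 := ((h.hasDerivAt (T - t) n).comp_const_sub T t).neg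
    refine (h1.congr_deriv ?_).hasDerivWithinAt
    ring
  finite_energy t _ := (h.finite_energy (T - t) trivial).neg

end Dissipation

/-! ### Coalescence and non-uniqueness -/

theorem IsSelfSimilarSolution.exists_coalescing {t₀ : ℝ} {a : ℕ → ℝ} {X : ℝ → ℕ → ℝ}
    (h : IsSelfSimilarSolution t₀ a X) {t₁ : ℝ} (ht₁ : t₀ < t₁) :
    ∃ Z : ℝ → ℕ → ℝ, IsFiniteEnergySolution (Iic t₁) Z ∧
      Z t₁ = X t₁ ∧ ∀ t ∈ Ioo t₀ t₁, Z t ≠ X t := by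
  have hsum : Summable fun i => X t₁ i ^ 2 := by
    simpa using (h.finite_energy t₁ ht₁).summable (by norm_num)
  obtain ⟨Z, hZ, hZ1, hE⟩ := exists_solution t₁ (h.zero t₁ ht₁)
    (S := ∑' i, X t₁ i ^ 2) fun n => hsum.sum_le_tsum _ fun _ _ => sq_nonneg _
  refine ⟨Z, hZ.mono (subset_univ _), hZ1, fun t ht heq => ?_⟩
  obtain ⟨j, hj⟩ := Function.ne_iff.1 h.nontrivial
  have hpos : 0 < t - t₀ := sub_pos.2 ht.1
  have hlt : t - t₀ < t₁ - t₀ := by linarith [ht.2]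
  have hXt : ∀ i, X t i ^ 2 = ((t₁ - t₀) / (t - t₀)) ^ 2 * X t₁ i ^ 2 := fun i => by
    rw [h.form t ht.1, h.form t₁ ht₁]
    have := hpos.ne'
    have := (hpos.trans hlt).ne'
    field_simp
  have hSpos : 0 < ∑' i, X t₁ i ^ 2 := by
    refine hsum.tsum_pos (fun _ => sq_nonneg _) j (sq_pos_of_ne_zero ?_)
    rw [h.form t₁ ht₁]
    exact div_ne_zero hj (hpos.trans hlt).ne'
  -- If the solutions met at `t`, the energy bound on `Z` would apply to `X t`, whose energy is
  -- larger than at `t₁` by the square of this ratio.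
  have hle : ((t₁ - t₀) / (t - t₀)) ^ 2 * ∑' i, X t₁ i ^ 2 ≤ ∑' i, X t₁ i ^ 2 := by
    refine le_of_tendsto (hsum.hasSum.tendsto_sum_nat.const_mul _) (Eventually.of_forall
      fun n => ?_)
    rw [mul_sum, ← sum_congr rfl fun i _ => hXt i, ← heq]
    exact hE t n
  have hgt : 1 < ((t₁ - t₀) / (t - t₀)) ^ 2 :=
    one_lt_pow₀ ((one_lt_div hpos).2 hlt) two_ne_zero
  nlinarith

theorem exists_nonunique : ∃ Y Z : ℝ → ℕ → ℝ,
    IsFiniteEnergySolution (Ici 0) Y ∧ IsFiniteEnergySolution (Ici 0) Z ∧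
      (∀ n : ℕ, Y 0 n ≤ 0) ∧ Y 0 = Z 0 ∧ ∃ t : ℝ, 0 < t ∧ Y t ≠ Z t := by
  obtain ⟨X, hX, hX0, hE⟩ := exists_solution 0 (u := fun n => if n = 1 then 1 else 0) (S := 1)
    (by simp) fun n => by
      simp only [ite_pow, one_pow, ne_eq, two_ne_zero, not_false_eq_true, zero_pow,
        sum_ite_eq']
      split_ifs <;> norm_num
  have h0 : ∀ n, 0 ≤ X 0 n := fun n => by
    rw [hX0]
    dsimp only
    split_ifs <;> norm_num
  obtain ⟨Z, hZ, hZ0, hEZ⟩ := exists_solution 0 (u := fun n => -X 32 n) (S := 3 / 4)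
    (by simp [hX.zero 32 trivial]) (by simpa using hX.energy_le h0 hE)
  refine ⟨fun t n => -X (32 - t) n, Z, (hX.reverse 32).mono (subset_univ _),
    hZ.mono (subset_univ _), fun n => ?_, ?_, 32, by norm_num, fun heq => ?_⟩
  · simpa using hX.nonneg h0 (by norm_num : (0 : ℝ) ≤ 32) n
  · rw [hZ0]
    simp
  -- At time `32` the reversed solution is minus the unit vector, of energy `1 > 3/4`; two terms
  -- suffice to see its only nonzero component.
  · have h := hEZ 32 2
    rw [← heq] at h
    norm_num [sum_range_succ, hX0] at h

end Dyadic

theorem mainTheorem9 :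
    (∀ (t₀ : ℝ) (a : ℕ → ℝ) (X : ℝ → ℕ → ℝ), Dyadic.IsSelfSimilarSolution t₀ a X →
      ∀ t₁ : ℝ, t₀ < t₁ →
        ∃ Z : ℝ → ℕ → ℝ, Dyadic.IsFiniteEnergySolution (Set.Iic t₁) Z ∧
          Z t₁ = X t₁ ∧ ∀ t ∈ Set.Ioo t₀ t₁, Z t ≠ X t) ∧
    (∃ Y Z : ℝ → ℕ → ℝ,
      Dyadic.IsFiniteEnergySolution (Set.Ici 0) Y ∧
      Dyadic.IsFiniteEnergySolution (Set.Ici 0) Z ∧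
      (∀ n : ℕ, Y 0 n ≤ 0) ∧ Y 0 = Z 0 ∧ ∃ t : ℝ, 0 < t ∧ Y t ≠ Z t) :=
  ⟨fun _ _ _ h _ ht₁ => h.exists_coalescing ht₁, Dyadic.exists_nonunique⟩
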